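/- Let $a_0 > 0$. The Buckley--Osthus model with parameter $a_0$ is the random growing multigraph that starts at time $1$ with a single node, labelled $1$, carrying a self-loop, and in which, for each $i \ge 1$, node $i+1$ is added together with one edge joining it to a random node $v \in \{1,\dots,i+1\}$; conditionally on the graph at time $i$, the probability of joining $v$ is $$\frac{d_i(v)+a_0-1}{(a_0+1)i+a_0}\quad (v \le i), \qquad \frac{a_0}{(a_0+1)i+a_0}\quad (v=i+1),$$ where $d_i(v)$ is the degree of node $v$ at time $i$ and a self-loop contributes $2$ to the degree. For $k \ge 1$ let $Z_k^n$ be the number of nodes of degree $k$ at time $n$ (when there are $n$ nodes and $n$ edges). Then, for every $k \ge 1$, almost surely $$\frac{Z_k^n}{n} \longrightarrow p_k := \frac{(a_0+1)\,a_0^{(k-1)}}{(2a_0+1)^{(k)}} \qquad (n \to \infty),$$ where $x^{(m)} := \prod_{j=0}^{m-1}(x+j)$ is the rising factorial, with $x^{(0)} := 1$. -/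

import Mathlib

open MeasureTheory Filter
open scoped Topology

namespace BuckleyOsthus

/-- A growing multigraph is encoded by its attachment sequence `t`: at time `i ≥ 1` node `i` is
added together with one edge joining `i` to `t i`; this edge is a self-loop if `t i = i`.
`degree t n v` is the degree of node `v` in the graph at time `n`, which has nodes `1, …, n` and the
edges `{i, t i}`, `1 ≤ i ≤ n`. Every edge contributes its two ends, so a self-loop counts twice. -/
def degree (t : ℕ → ℕ) (n v : ℕ) : ℕ :=
  ∑ i ∈ Finset.Icc 1 n, ((if i = v then 1 else 0) + (if t i = v then 1 else 0))

/-- `degreeCount t k n` is `Z_k^n`, the number of nodes of degree `k` in the graph at time `n`. -/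
def degreeCount (t : ℕ → ℕ) (k n : ℕ) : ℕ :=
  ((Finset.Icc 1 n).filter (fun v => degree t n v = k)).card

/-- The attachment rule with parameter `a`: given the graph at time `i`, the probability that
node `i + 1` is joined to `v`. -/
noncomputable def attachProb (a : ℝ) (t : ℕ → ℕ) (i v : ℕ) : ℝ :=
  if 1 ≤ v ∧ v ≤ i then ((degree t i v : ℝ) + a - 1) / ((a + 1) * (i : ℝ) + a)
  else if v = i + 1 then a / ((a + 1) * (i : ℝ) + a)
  else 0

/-- The information carried by the (labelled) graph at time `i`: the σ-algebra generated by
`V 1, …, V i`. -/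
abbrev history {Ω : Type*} (V : ℕ → Ω → ℕ) (i : ℕ) : MeasurableSpace Ω :=
  ⨆ j ∈ Finset.Icc 1 i, MeasurableSpace.comap (V j) ⊤

/-- The random attachment sequence `V` is a Buckley–Osthus process with parameter `a` under `μ`:
it starts from the single node `1` with a self-loop, and for `i ≥ 1` the conditional law of
`V (i + 1)`, given the graph at time `i`, is the attachment rule. -/
structure IsProcess {Ω : Type*} [MeasurableSpace Ω] (μ : Measure Ω) (a : ℝ)
    (V : ℕ → Ω → ℕ) : Prop where
  measurable : ∀ i, 1 ≤ i → Measurable (V i)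
  start : ∀ᵐ ω ∂μ, V 1 ω = 1
  attach : ∀ i, 1 ≤ i → ∀ v : ℕ,
    μ[Set.indicator {ω | V (i + 1) ω = v} (fun _ => (1 : ℝ)) | history V i]
      =ᵐ[μ] fun ω => attachProb a (fun j => V j ω) i v

/-- `p_k = (a + 1) a^{(k-1)} / (2a + 1)^{(k)}` for `k ≥ 1`, with `x^{(n)} = x (x+1) ⋯ (x+n-1)`. -/
noncomputable def limitProportion (a : ℝ) (k : ℕ) : ℝ :=
  (a + 1) * (ascPochhammer ℝ (k - 1)).eval a / (ascPochhammer ℝ k).eval (2 * a + 1)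

end BuckleyOsthus

/-!
The number `Z_k^n` of nodes of degree `k` at time `n` satisfies a linear recursion with noise. Given
the graph at time `n`, attaching the new edge turns a node of degree `k - 1` into one of degree `k`
with probability `(k - 2 + a) Z_{k-1}^n / ((a + 1) n + a)` and a node of degree `k` into one of
degree `k + 1` with probability `(k - 1 + a) Z_k^n / ((a + 1) n + a)`, up to the bounded correction
for the new node, which itself starts with degree `1` or `2`. This correction disappears from the
formulas if the new node is counted with degree `1` before its edge is attached
(`midDegree`, `midCount`): the attachment probability of `v` is then proportional to
`midDegree + a - 1` for the old nodes and the new one alike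
(`attachProb_eq`, `sum_gain_mul_attachProb`).

The noise consists of bounded martingale differences, so its averages tend to `0` almost surely
(`ae_tendsto_average_sub_condExp`). From there on the argument is deterministic. A sequence with
`x (n + 1) = (1 - b n) x n + r n + ξ n`, `n b n → β`, `r n → r` and with averages of `ξ` tending to
`0` satisfies `x n / n → r / (1 + β)` (`tendsto_div_of_linear_recursion`). If `Z_{k-1}^n / n`
tends to `p_{k-1}`, this applies to `Z_k^n` with `β = (k - 1 + a) / (a + 1)` and
`r = (k - 2 + a) / (a + 1) * p_{k-1}`, plus `1` if `k = 1`; so `Z_k^n / n → p_k` follows by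
induction on `k`, starting from `Z_0^n = 0`, that is, with `p_0` read as `0`.
-/

/-! ### A strong law for bounded martingale differences -/

/-- **Kronecker's lemma** with weights `j + 1`: if `∑ x j / (j + 1)` converges, then the averages
of `x` tend to `0`. -/
theorem tendsto_average_zero_of_tendsto_sum_div {x : ℕ → ℝ} {c : ℝ}
    (h : Tendsto (fun n => ∑ j ∈ Finset.range n, ((j : ℝ) + 1)⁻¹ * x j) atTop (𝓝 c)) :
    Tendsto (fun n : ℕ => (∑ j ∈ Finset.range n, x j) / (n : ℝ)) atTop (𝓝 0) := by
  set s : ℕ → ℝ := fun n => ∑ j ∈ Finset.range n, ((j : ℝ) + 1)⁻¹ * x j with hs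
  -- summation by parts
  have hparts : ∀ n : ℕ, ∑ j ∈ Finset.range n, x j
      = n * s n - ∑ j ∈ Finset.range n, s j := by
    intro n
    induction n with
    | zero => simp
    | succ n ih =>
      have hstep : s (n + 1) = s n + ((n : ℝ) + 1)⁻¹ * x n := Finset.sum_range_succ _ _
      have hn : (n : ℝ) + 1 ≠ 0 := by positivity
      rw [Finset.sum_range_succ, Finset.sum_range_succ, ih, hstep]
      push_cast
      field_simp
      ring
  have hlim : Tendsto (fun n : ℕ => s n - (n : ℝ)⁻¹ * ∑ j ∈ Finset.range n, s j) atTop (𝓝 0) := by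
    simpa using h.sub h.cesaro
  refine hlim.congr' ?_
  filter_upwards [eventually_gt_atTop 0] with n hn
  have hn' : (n : ℝ) ≠ 0 := by positivity
  rw [hparts n]
  field_simp

/-- **Strong law of large numbers** for bounded martingale differences: the averages of
`D j - μ[D j | ℱ j]` tend to `0` almost surely. The sums weighted by `(j + 1)⁻¹` form a martingale
bounded in `L²`, as its increments are orthogonal and `∑ (j + 1)⁻²` converges; so they converge
almost surely, and Kronecker's lemma applies. -/
theorem ae_tendsto_average_sub_condExp {Ω : Type*} {m0 : MeasurableSpace Ω} {μ : Measure Ω}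
    [IsProbabilityMeasure μ] {ℱ : Filtration ℕ m0} {D : ℕ → Ω → ℝ} {C : ℝ}
    (hD : ∀ n, StronglyMeasurable[ℱ (n + 1)] (D n)) (hC : ∀ n ω, ‖D n ω‖ ≤ C) :
    ∀ᵐ ω ∂μ, Tendsto
      (fun n : ℕ => (∑ j ∈ Finset.range n, (D j ω - (μ[D j | ℱ j]) ω)) / (n : ℝ))
      atTop (𝓝 0) := by
  set ξ : ℕ → Ω → ℝ := fun j => D j - μ[D j | ℱ j] with hξ
  set M : ℕ → Ω → ℝ := fun n => ∑ j ∈ Finset.range n, ((j : ℝ) + 1)⁻¹ • ξ j with hM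
  have hξmeas : ∀ j, StronglyMeasurable[ℱ (j + 1)] (ξ j) := fun j =>
    (hD j).sub (stronglyMeasurable_condExp.mono (ℱ.mono j.le_succ))
  have hDint : ∀ j, Integrable (D j) μ := fun j =>
    Integrable.of_bound ((hD j).mono (ℱ.le _)).aestronglyMeasurable C (.of_forall (hC j))
  have hξbdd : ∀ j, ∀ᵐ ω ∂μ, ‖ξ j ω‖ ≤ 2 * C := by
    intro j
    filter_upwards [ae_bdd_norm_condExp_of_ae_bdd_norm (m := ℱ j) (.of_forall (hC j))] with ω hω
    calc ‖D j ω - (μ[D j | ℱ j]) ω‖ ≤ ‖D j ω‖ + ‖(μ[D j | ℱ j]) ω‖ := norm_sub_le _ _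
      _ ≤ C + C := add_le_add (hC j ω) hω
      _ = 2 * C := by ring
  have hξL2 : ∀ j, MemLp (ξ j) 2 μ := fun j =>
    MemLp.of_bound ((hξmeas j).mono (ℱ.le _)).aestronglyMeasurable (2 * C) (hξbdd j)
  have hξcond : ∀ j, μ[ξ j | ℱ j] =ᵐ[μ] 0 := by
    intro j
    have h2 : μ[μ[D j | ℱ j] | ℱ j] = μ[D j | ℱ j] :=
      condExp_of_stronglyMeasurable (ℱ.le j) stronglyMeasurable_condExp integrable_condExp
    filter_upwards [condExp_sub (hDint j) (integrable_condExp (m := ℱ j) (f := D j)) (ℱ j)]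
      with ω hω
    simp [hξ, hω, h2]
  have hMmeas : ∀ n, StronglyMeasurable[ℱ n] (M n) := fun n =>
    Finset.stronglyMeasurable_sum _ fun j hj =>
      ((hξmeas j).mono (ℱ.mono (Finset.mem_range.1 hj))).const_smul _
  have hML2 : ∀ n, MemLp (M n) 2 μ := fun n =>
    memLp_finsetSum' _ fun j _ => (hξL2 j).const_smul _
  have hMint : ∀ n, Integrable (M n) μ := fun n => (hML2 n).integrable one_le_two
  have hMsucc : ∀ n, M (n + 1) = M n + ((n : ℝ) + 1)⁻¹ • ξ n := fun n =>
    Finset.sum_range_succ _ _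
  have hmart : Martingale M ℱ μ := by
    refine martingale_of_condExp_sub_eq_zero_nat hMmeas hMint fun n => ?_
    rw [hMsucc, add_sub_cancel_left]
    filter_upwards [condExp_smul (μ := μ) ((n : ℝ) + 1)⁻¹ (ξ n) (ℱ n), hξcond n] with ω h1 h2
    simp [h1, h2]
  have horth : ∀ n, ∫ ω, M n ω * ξ n ω ∂μ = 0 := by
    intro n
    have hprod : Integrable (M n * ξ n) μ := (hML2 n).integrable_mul (hξL2 n)
    have h := condExp_mul_of_stronglyMeasurable_left (hMmeas n) hprod
      ((hξL2 n).integrable one_le_two)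
    calc ∫ ω, M n ω * ξ n ω ∂μ = ∫ ω, (μ[M n * ξ n | ℱ n]) ω ∂μ := (integral_condExp (ℱ.le n)).symm
      _ = ∫ _, (0 : ℝ) ∂μ := by
        refine integral_congr_ae ?_
        filter_upwards [h, hξcond n] with ω h1 h2
        simp [h1, h2]
      _ = 0 := integral_zero _ _
  have hsq : ∀ n, ∫ ω, M n ω ^ 2 ∂μ
      ≤ ∑ j ∈ Finset.range n, (2 * C) ^ 2 * (1 / ((j : ℝ) + 1) ^ 2) := by
    intro n
    induction n with
    | zero => simp [hM]
    | succ n ih =>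
      have hexp : ∀ ω, M (n + 1) ω ^ 2 = M n ω ^ 2
          + (2 * ((n : ℝ) + 1)⁻¹ * (M n ω * ξ n ω) + 1 / ((n : ℝ) + 1) ^ 2 * ξ n ω ^ 2) := by
        intro ω
        rw [hMsucc]
        simp only [Pi.add_apply, Pi.smul_apply, smul_eq_mul]
        field_simp
        ring
      have hi1 : Integrable (fun ω => M n ω ^ 2) μ := (hML2 n).integrable_sq
      have hi2 : Integrable (fun ω => 2 * ((n : ℝ) + 1)⁻¹ * (M n ω * ξ n ω)) μ :=
        ((hML2 n).integrable_mul (hξL2 n)).const_mul _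
      have hi3 : Integrable (fun ω => 1 / ((n : ℝ) + 1) ^ 2 * ξ n ω ^ 2) μ :=
        (hξL2 n).integrable_sq.const_mul _
      have hξsq : ∫ ω, ξ n ω ^ 2 ∂μ ≤ (2 * C) ^ 2 := by
        have hle : ∫ ω, ξ n ω ^ 2 ∂μ ≤ ∫ _, (2 * C) ^ 2 ∂μ := by
          refine integral_mono_ae (hξL2 n).integrable_sq (integrable_const _) ?_
          filter_upwards [hξbdd n] with ω hω
          rw [Real.norm_eq_abs] at hω
          exact sq_le_sq' (by linarith [neg_abs_le (ξ n ω)]) ((le_abs_self _).trans hω)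
        simpa using hle
      simp_rw [hexp]
      have hi23 : Integrable (fun ω => 2 * ((n : ℝ) + 1)⁻¹ * (M n ω * ξ n ω)
          + 1 / ((n : ℝ) + 1) ^ 2 * ξ n ω ^ 2) μ := hi2.add hi3
      rw [integral_add hi1 hi23, integral_add hi2 hi3, integral_const_mul,
        integral_const_mul, horth, Finset.sum_range_succ, mul_zero, zero_add,
        mul_comm ((2 * C) ^ 2) (1 / ((n : ℝ) + 1) ^ 2)]
      exact add_le_add ih (mul_le_mul_of_nonneg_left hξsq (by positivity))
  have hsummable : Summable fun j : ℕ => (2 * C) ^ 2 * (1 / ((j : ℝ) + 1) ^ 2) := by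
    have h := (summable_nat_add_iff 1).2 (Real.summable_one_div_nat_pow.2 one_lt_two)
    refine Summable.mul_left _ ?_
    simpa using h
  set B : ℝ := ∑' j : ℕ, (2 * C) ^ 2 * (1 / ((j : ℝ) + 1) ^ 2) with hB
  have hL1 : ∀ n, eLpNorm (M n) 1 μ ≤ (1 + B).toNNReal := by
    intro n
    rw [eLpNorm_one_eq_lintegral_enorm, ← ofReal_integral_norm_eq_lintegral_enorm (hMint n)]
    refine ENNReal.ofReal_le_ofReal ?_
    have hle : ∫ ω, ‖M n ω‖ ∂μ ≤ ∫ ω, (1 + M n ω ^ 2) ∂μ := by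
      refine integral_mono (hMint n).norm ((integrable_const _).add (hML2 n).integrable_sq) ?_
      intro ω
      change |M n ω| ≤ 1 + M n ω ^ 2
      nlinarith [sq_nonneg (|M n ω| - 1), sq_abs (M n ω), sq_nonneg (M n ω)]
    have hadd : ∫ ω, (1 + M n ω ^ 2) ∂μ = 1 + ∫ ω, M n ω ^ 2 ∂μ := by
      rw [integral_add (integrable_const _) (hML2 n).integrable_sq]
      simp
    have hBn := hsummable.sum_le_tsum (Finset.range n) fun j _ => by positivity
    linarith [hsq n]
  filter_upwards [hmart.submartingale.exists_ae_tendsto_of_bdd hL1] with ω hω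
  obtain ⟨c, hc⟩ := hω
  refine tendsto_average_zero_of_tendsto_sum_div (c := c) (hc.congr fun n => ?_)
  simp [hM, hξ, Finset.sum_apply]

/-! ### Asymptotics of a perturbed linear recursion -/

/-- A sequence driven by `x (n + 1) = (1 - b n) * x n + r n + ξ n`, where `n * b n → β`, `r n → r`
and the averages of `ξ` vanish, grows linearly with slope `r / (1 + β)`, the solution `ρ` of
`ρ = r - β * ρ`. -/
theorem tendsto_div_of_linear_recursion {x b r ξ : ℕ → ℝ} {β r' : ℝ} (hβ : 0 ≤ β)
    (hb0 : ∀ n, 0 ≤ b n) (hb : Tendsto (fun n : ℕ => (n : ℝ) * b n) atTop (𝓝 β))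
    (hr : Tendsto r atTop (𝓝 r'))
    (hξ : Tendsto (fun n : ℕ => (∑ j ∈ Finset.range n, ξ j) / (n : ℝ)) atTop (𝓝 0))
    (hx : ∀ n, 1 ≤ n → x (n + 1) = (1 - b n) * x n + r n + ξ n) :
    Tendsto (fun n : ℕ => x n / (n : ℝ)) atTop (𝓝 (r' / (1 + β))) := by
  have hβ1 : 1 + β ≠ 0 := by positivity
  set ρ : ℝ := r' / (1 + β) with hρ
  have hρeq : ρ = r' - β * ρ := by rw [hρ]; field_simp; ring
  set Ξ : ℕ → ℝ := fun n => ∑ j ∈ Finset.range n, ξ j with hΞ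
  -- the deviation of `x` from its linear prediction, once the noise is removed
  set u : ℕ → ℝ := fun n => x n - Ξ n - ρ * n with hu
  set e : ℕ → ℝ := fun n => -(n * b n * (Ξ n / n)) + (r n - r') + ρ * (β - n * b n) with he
  have he0 : Tendsto e atTop (𝓝 0) := by
    have h := ((hb.mul hξ).neg.add (hr.sub_const r')).add ((hb.const_sub β).const_mul ρ)
    simpa using h
  have hstep : ∀ n, 1 ≤ n → u (n + 1) = (1 - b n) * u n + e n := by
    intro n hn
    have hn' : (n : ℝ) ≠ 0 := by positivity
    have hΞs : Ξ (n + 1) = Ξ n + ξ n := Finset.sum_range_succ _ _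
    have hcancel : (n : ℝ) * b n * (Ξ n / n) = b n * Ξ n := by field_simp
    simp only [hu, he, hcancel, hx n hn, hΞs]
    push_cast
    linear_combination -hρeq
  have hbsmall : ∀ᶠ n in atTop, b n ≤ 1 := by
    filter_upwards [hb.eventually (gt_mem_nhds (lt_add_one β)),
      tendsto_natCast_atTop_atTop.eventually_ge_atTop (β + 1)] with n h1 h2
    by_contra! h3
    nlinarith
  obtain ⟨N, hN⟩ := eventually_atTop.1 (hbsmall.and (eventually_ge_atTop 1))
  have hbound : ∀ n, N ≤ n → |u n| ≤ |u N| + ∑ j ∈ Finset.range n, |e j| := by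
    intro n hn
    induction n, hn using Nat.le_induction with
    | base => exact le_add_of_nonneg_right (Finset.sum_nonneg fun _ _ => abs_nonneg _)
    | succ n hn ih =>
      obtain ⟨hbn, hn1⟩ := hN n hn
      have hcontract : |(1 - b n) * u n| ≤ |u n| := by
        rw [abs_mul, abs_of_nonneg (by linarith : 0 ≤ 1 - b n)]
        exact mul_le_of_le_one_left (abs_nonneg _) (by linarith [hb0 n])
      rw [hstep n hn1, Finset.sum_range_succ]
      linarith [abs_add_le ((1 - b n) * u n) (e n)]
  have hu0 : Tendsto (fun n : ℕ => u n / (n : ℝ)) atTop (𝓝 0) := by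
    have hmaj : Tendsto (fun n : ℕ => |u N| / (n : ℝ) + (n : ℝ)⁻¹ * ∑ j ∈ Finset.range n, |e j|)
        atTop (𝓝 0) := by
      have habs : Tendsto (fun n => |e n|) atTop (𝓝 0) := by simpa using he0.abs
      simpa using (tendsto_const_div_atTop_nhds_zero_nat |u N|).add habs.cesaro
    refine squeeze_zero_norm' ?_ hmaj
    filter_upwards [eventually_ge_atTop N] with n hn
    rw [norm_div, Real.norm_eq_abs, RCLike.norm_natCast, inv_mul_eq_div, ← add_div]
    gcongr
    exact hbound n hn
  have hsum := (hu0.add hξ).add_const ρ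
  rw [zero_add, zero_add] at hsum
  refine hsum.congr' ?_
  filter_upwards [eventually_gt_atTop 0] with n hn
  have hn' : (n : ℝ) ≠ 0 := by positivity
  simp only [hu]
  field_simp
  ring

namespace BuckleyOsthus

/-! ### One attachment step of a fixed graph -/

/-- The degree of node `v` in the middle of the step from time `n` to time `n + 1`: node `n + 1` is
present with its own end of the new edge, and the other end of that edge is not yet attached. -/
def midDegree (t : ℕ → ℕ) (n v : ℕ) : ℕ :=
  degree t n v + if n + 1 = v then 1 else 0

/-- The number, as a real, of nodes `v ∈ {1, …, n + 1}` with `midDegree t n v = k`. -/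
noncomputable def midCount (t : ℕ → ℕ) (k n : ℕ) : ℝ :=
  ∑ v ∈ Finset.Icc 1 (n + 1), if midDegree t n v = k then 1 else 0

/-- The change in the number of nodes of degree `k` when the loose end of the new edge is attached
to node `v`. -/
noncomputable def gain (t : ℕ → ℕ) (k n v : ℕ) : ℝ :=
  (if midDegree t n v + 1 = k then 1 else 0) - if midDegree t n v = k then 1 else 0

/-- The change in the number of nodes of degree `k` when the loose end is attached to
`t (n + 1)`, as a sum over the possible targets. -/
noncomputable def increment (t : ℕ → ℕ) (k n : ℕ) : ℝ :=
  ∑ v ∈ Finset.Icc 1 (n + 1), gain t k n v * if t (n + 1) = v then 1 else 0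

variable {t : ℕ → ℕ}

theorem degree_succ (t : ℕ → ℕ) (n v : ℕ) :
    degree t (n + 1) v = midDegree t n v + if t (n + 1) = v then 1 else 0 := by
  rw [degree, Finset.sum_Icc_succ_top (by omega), ← degree, midDegree, add_assoc]

theorem degree_of_lt (ht : ∀ i, 1 ≤ i → t i ≤ i) {n v : ℕ} (hv : n < v) : degree t n v = 0 := by
  refine Finset.sum_eq_zero fun i hi => ?_
  obtain ⟨h1, h2⟩ := Finset.mem_Icc.1 hi
  have := ht i h1
  rw [if_neg (by omega), if_neg (by omega), add_zero]

theorem degree_pos {n v : ℕ} (h1 : 1 ≤ v) (hn : v ≤ n) : 0 < degree t n v := by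
  refine Finset.sum_pos' (fun _ _ => Nat.zero_le _) ⟨v, Finset.mem_Icc.2 ⟨h1, hn⟩, ?_⟩
  simp

theorem degreeCount_eq_sum (t : ℕ → ℕ) (k n : ℕ) :
    (degreeCount t k n : ℝ) = ∑ v ∈ Finset.Icc 1 n, if degree t n v = k then 1 else 0 := by
  simp [degreeCount]

theorem degreeCount_zero (t : ℕ → ℕ) (n : ℕ) : degreeCount t 0 n = 0 := by
  rw [degreeCount, Finset.card_eq_zero, Finset.filter_eq_empty_iff]
  intro v hv
  obtain ⟨h1, h2⟩ := Finset.mem_Icc.1 hv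
  exact (degree_pos h1 h2).ne'

theorem midDegree_succ_self (ht : ∀ i, 1 ≤ i → t i ≤ i) (n : ℕ) : midDegree t n (n + 1) = 1 := by
  simp [midDegree, degree_of_lt ht n.lt_succ_self]

theorem midCount_eq (ht : ∀ i, 1 ≤ i → t i ≤ i) (k n : ℕ) :
    midCount t k n = degreeCount t k n + if k = 1 then 1 else 0 := by
  rw [midCount, Finset.sum_Icc_succ_top (by omega), midDegree_succ_self ht, degreeCount_eq_sum]
  congr 1
  · refine Finset.sum_congr rfl fun v hv => ?_
    have := (Finset.mem_Icc.1 hv).2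
    rw [midDegree, if_neg (by omega : ¬ n + 1 = v), add_zero]
  · simp [eq_comm]

theorem degreeCount_succ (t : ℕ → ℕ) (k n : ℕ) :
    (degreeCount t k (n + 1) : ℝ) = midCount t k n + increment t k n := by
  rw [degreeCount_eq_sum, midCount, increment, ← Finset.sum_add_distrib]
  refine Finset.sum_congr rfl fun v _ => ?_
  rw [degree_succ, gain]
  by_cases h : t (n + 1) = v <;> simp [h]

/-- In terms of `midDegree`, the attachment rule is the same for old nodes and for the new one. -/
theorem attachProb_eq (ht : ∀ i, 1 ≤ i → t i ≤ i) (a : ℝ) {n v : ℕ}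
    (hv : v ∈ Finset.Icc 1 (n + 1)) :
    attachProb a t n v = (midDegree t n v + a - 1) / ((a + 1) * n + a) := by
  obtain ⟨h1, h2⟩ := Finset.mem_Icc.1 hv
  rcases h2.lt_or_eq with h | rfl
  · rw [attachProb, if_pos ⟨h1, by omega⟩, midDegree, if_neg (by omega : ¬ n + 1 = v), add_zero]
  · rw [attachProb, if_neg (by omega), if_pos rfl, midDegree_succ_self ht]
    simp

/-- The conditional mean of the increment of the number of nodes of degree `m + 1`: attachment to a
node of degree `m` creates one, attachment to a node of degree `m + 1` destroys one. -/
theorem sum_gain_mul_attachProb (ht : ∀ i, 1 ≤ i → t i ≤ i) (a : ℝ) (m n : ℕ) :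
    ∑ v ∈ Finset.Icc 1 (n + 1), gain t (m + 1) n v * attachProb a t n v
      = ((m + a - 1) * midCount t m n - (m + a) * midCount t (m + 1) n)
        / ((a + 1) * n + a) := by
  rw [midCount, midCount, Finset.mul_sum, Finset.mul_sum, ← Finset.sum_sub_distrib,
    Finset.sum_div]
  refine Finset.sum_congr rfl fun v hv => ?_
  rw [attachProb_eq ht a hv, gain, mul_div_assoc']
  congr 1
  by_cases h0 : midDegree t n v = m
  · simp [h0]
  · by_cases h1 : midDegree t n v = m + 1
    · simp [h1]
      ring
    · simp [h0, h1]

theorem abs_gain_le (t : ℕ → ℕ) (k n v : ℕ) : |gain t k n v| ≤ 1 := by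
  unfold gain
  split_ifs <;> norm_num

theorem abs_increment_le (t : ℕ → ℕ) (k n : ℕ) : |increment t k n| ≤ 1 := by
  simp only [increment, mul_ite, mul_one, mul_zero, Finset.sum_ite_eq]
  split_ifs
  · exact abs_gain_le _ _ _ _
  · simp

/-! ### The attachment process -/

section AttachmentProcess

variable {Ω : Type*} {V : ℕ → Ω → ℕ}

theorem measurable_history {i j : ℕ} (hj : j ∈ Finset.Icc 1 i) : Measurable[history V i] (V j) :=
  (comap_measurable (V j)).mono
    (le_iSup₂ (f := fun j (_ : j ∈ Finset.Icc 1 i) => MeasurableSpace.comap (V j) ⊤) j hj) le_rfl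

theorem measurable_gain (k n v : ℕ) :
    Measurable[history V n] fun ω => gain (fun j => V j ω) k n v := by
  have hdeg : Measurable[history V n] fun ω => degree (fun j => V j ω) n v :=
    Finset.measurable_sum _ fun i hi =>
      (measurable_from_top
        (f := fun w : ℕ => (if i = v then 1 else 0) + if w = v then 1 else 0)).comp
        (measurable_history hi)
  exact (measurable_from_top (f := fun d : ℕ =>
    ((if (d + if n + 1 = v then 1 else 0) + 1 = k then 1 else 0) -
      if (d + if n + 1 = v then 1 else 0) = k then 1 else 0 : ℝ))).comp hdeg

theorem measurable_increment (k n : ℕ) :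
    Measurable[history V (n + 1)] fun ω => increment (fun j => V j ω) k n := by
  have hle : history V n ≤ history V (n + 1) :=
    biSup_mono fun _ hk => Finset.Icc_subset_Icc_right n.le_succ hk
  refine Finset.measurable_sum _ fun v _ => ((measurable_gain k n v).mono hle le_rfl).mul ?_
  exact (measurable_from_top (f := fun w : ℕ => if w = v then (1 : ℝ) else 0)).comp
    (measurable_history (Finset.mem_Icc.2 ⟨by omega, le_rfl⟩))

variable [MeasurableSpace Ω] {μ : Measure Ω} {a : ℝ}

/-- The σ-algebras `history V i` as a filtration. -/
def historyFiltration (V : ℕ → Ω → ℕ) (hV : ∀ i, 1 ≤ i → Measurable (V i)) :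
    Filtration ℕ ‹MeasurableSpace Ω› where
  seq := history V
  mono' _ _ hij := biSup_mono fun _ hk => Finset.Icc_subset_Icc_right hij hk
  le' _ := iSup₂_le fun j hj => (hV j (Finset.mem_Icc.1 hj).1).comap_le

/-- Almost surely no node is joined to a later one: such targets have conditional
probability `0`. -/
theorem IsProcess.ae_le [IsProbabilityMeasure μ] (hV : IsProcess μ a V) :
    ∀ᵐ ω ∂μ, ∀ i, 1 ≤ i → V i ω ≤ i := by
  have hnull : ∀ i, 1 ≤ i → ∀ v, i + 1 < v → ∀ᵐ ω ∂μ, V (i + 1) ω ≠ v := by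
    intro i hi v hv
    have hmeas : MeasurableSet {ω | V (i + 1) ω = v} :=
      hV.measurable (i + 1) (by omega) (measurableSet_singleton v)
    have hzero : μ.real {ω | V (i + 1) ω = v} = 0 := by
      rw [← integral_indicator_one hmeas]
      change ∫ ω, Set.indicator {ω | V (i + 1) ω = v} (fun _ => (1 : ℝ)) ω ∂μ = 0
      rw [← integral_condExp ((historyFiltration V hV.measurable).le i)]
      refine (integral_congr_ae (hV.attach i hi v)).trans ?_
      simp [attachProb, show ¬ (1 ≤ v ∧ v ≤ i) by omega, show v ≠ i + 1 by omega]
    rw [measureReal_eq_zero_iff] at hzero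
    simpa [ae_iff] using hzero
  have hall : ∀ᵐ ω ∂μ, ∀ i, 1 ≤ i → ∀ v, i + 1 < v → V (i + 1) ω ≠ v := by
    simp only [ae_all_iff]
    exact hnull
  filter_upwards [hV.start, hall] with ω h1 h i hi
  obtain rfl | ⟨j, hj, rfl⟩ : i = 1 ∨ ∃ j, 1 ≤ j ∧ i = j + 1 := by
    rcases hi.eq_or_lt with h | h
    · exact .inl h.symm
    · exact .inr ⟨i - 1, by omega, by omega⟩
  · exact h1.le
  · by_contra! hlt
    exact h j hj _ hlt rfl

theorem IsProcess.condExp_increment [IsProbabilityMeasure μ] (hV : IsProcess μ a V) (k : ℕ) {n : ℕ}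
    (hn : 1 ≤ n) :
    μ[fun ω => increment (fun j => V j ω) k n | history V n] =ᵐ[μ] fun ω =>
      ∑ v ∈ Finset.Icc 1 (n + 1),
        gain (fun j => V j ω) k n v * attachProb a (fun j => V j ω) n v := by
  set g : ℕ → Ω → ℝ := fun v ω => gain (fun j => V j ω) k n v with hg
  set I : ℕ → Ω → ℝ := fun v => Set.indicator {ω | V (n + 1) ω = v} (fun _ => (1 : ℝ)) with hI
  have hle : history V n ≤ ‹MeasurableSpace Ω› := (historyFiltration V hV.measurable).le n
  have hgmeas : ∀ v, StronglyMeasurable[history V n] (g v) := fun v =>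
    (measurable_gain k n v).stronglyMeasurable
  have hgbdd : ∀ v, ∀ᵐ ω ∂μ, ‖g v ω‖ ≤ 1 := fun v => .of_forall fun ω => abs_gain_le _ _ _ _
  have hIint : ∀ v, Integrable (I v) μ := fun v =>
    (integrable_const 1).indicator
      (hV.measurable (n + 1) (by omega) (measurableSet_singleton v))
  have hprod : ∀ v, Integrable (g v * I v) μ := fun v =>
    (hIint v).bdd_mul ((hgmeas v).mono hle).aestronglyMeasurable (hgbdd v)
  have hsum : (fun ω => increment (fun j => V j ω) k n)
      = ∑ v ∈ Finset.Icc 1 (n + 1), g v * I v := by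
    ext ω
    simp [increment, hg, hI, Finset.sum_apply, Set.indicator_apply]
  rw [hsum]
  have hpull : ∀ᵐ ω ∂μ, ∀ v, (μ[g v * I v | history V n]) ω
      = g v ω * attachProb a (fun j => V j ω) n v := by
    refine ae_all_iff.2 fun v => ?_
    filter_upwards [condExp_stronglyMeasurable_mul_of_bound hle (hgmeas v) (hIint v) 1 (hgbdd v),
      hV.attach n hn v] with ω h1 h2
    rw [h1, Pi.mul_apply, h2]
  filter_upwards [condExp_finsetSum (fun v (_ : v ∈ Finset.Icc 1 (n + 1)) => hprod v)
    (history V n), hpull] with ω h1 h2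
  rw [h1, Finset.sum_apply]
  exact Finset.sum_congr rfl fun v _ => h2 v

/-- Almost surely, the numbers of nodes of degree `m + 1` follow the linear recursion given by the
attachment rule, up to a noise `ξ` whose averages vanish. -/
theorem IsProcess.ae_exists_recursion [IsProbabilityMeasure μ] (hV : IsProcess μ a V) (m : ℕ) :
    ∀ᵐ ω ∂μ, ∃ ξ : ℕ → ℝ,
      Tendsto (fun n : ℕ => (∑ j ∈ Finset.range n, ξ j) / (n : ℝ)) atTop (𝓝 0) ∧
      ∀ n, 1 ≤ n → (degreeCount (fun j => V j ω) (m + 1) (n + 1) : ℝ)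
        = midCount (fun j => V j ω) (m + 1) n
          + ((m + a - 1) * midCount (fun j => V j ω) m n
            - (m + a) * midCount (fun j => V j ω) (m + 1) n) / ((a + 1) * n + a) + ξ n := by
  have hcond : ∀ᵐ ω ∂μ, ∀ n, 1 ≤ n →
      (μ[fun ω => increment (fun j => V j ω) (m + 1) n | history V n]) ω
        = ∑ v ∈ Finset.Icc 1 (n + 1),
          gain (fun j => V j ω) (m + 1) n v * attachProb a (fun j => V j ω) n v := by
    simp only [ae_all_iff]
    exact fun n hn => hV.condExp_increment (m + 1) hn
  filter_upwards [hcond, hV.ae_le,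
    ae_tendsto_average_sub_condExp (μ := μ) (ℱ := historyFiltration V hV.measurable)
      (D := fun n ω => increment (fun j => V j ω) (m + 1) n) (C := 1)
      (fun n => (measurable_increment (m + 1) n).stronglyMeasurable)
      (fun n ω => abs_increment_le _ _ _)] with ω h1 ht h2
  refine ⟨_, h2, fun n hn => ?_⟩
  have h1n := h1 n hn
  rw [sum_gain_mul_attachProb ht] at h1n
  rw [degreeCount_succ, ← h1n, add_assoc]
  congr 1
  exact (add_sub_cancel _ _).symm

end AttachmentProcess

/-! ### Limits of the proportions -/

/-- The asymptotics of the number of nodes of degree `m + 1`, given those of the number of nodes of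
degree `m`. -/
theorem tendsto_degreeCount_succ (ht : ∀ i, 1 ≤ i → t i ≤ i) {a : ℝ} (ha : 0 < a) {m : ℕ}
    {ξ : ℕ → ℝ} {q : ℝ}
    (hξ : Tendsto (fun n : ℕ => (∑ j ∈ Finset.range n, ξ j) / (n : ℝ)) atTop (𝓝 0))
    (hrec : ∀ n, 1 ≤ n → (degreeCount t (m + 1) (n + 1) : ℝ) = midCount t (m + 1) n
      + ((m + a - 1) * midCount t m n - (m + a) * midCount t (m + 1) n) / ((a + 1) * n + a) + ξ n)
    (hq : Tendsto (fun n : ℕ => (degreeCount t m n : ℝ) / (n : ℝ)) atTop (𝓝 q)) :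
    Tendsto (fun n : ℕ => (degreeCount t (m + 1) n : ℝ) / (n : ℝ)) atTop
      (𝓝 (((if m = 0 then 1 else 0) + (m + a - 1) / (a + 1) * q) / (1 + (m + a) / (a + 1)))) := by
  set δ : ℕ → ℝ := fun k => if k = 1 then 1 else 0 with hδ
  have hpos : ∀ n : ℕ, 0 < (a + 1) * n + a := fun n => by positivity
  have hratio : Tendsto (fun n : ℕ => (n : ℝ) / ((a + 1) * n + a)) atTop (𝓝 (1 / (a + 1))) := by
    have h : Tendsto (fun n : ℕ => 1 / ((a + 1) + a / (n : ℝ))) atTop (𝓝 (1 / (a + 1 + 0))) :=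
      tendsto_const_nhds.div (tendsto_const_nhds.add (tendsto_const_div_atTop_nhds_zero_nat a))
        (by positivity)
    rw [add_zero] at h
    refine h.congr' ?_
    filter_upwards [eventually_gt_atTop 0] with n hn
    have hn' : (n : ℝ) ≠ 0 := by positivity
    field_simp
  have hinv : Tendsto (fun n : ℕ => 1 / ((a + 1) * n + a)) atTop (𝓝 0) := by
    have h := hratio.mul (tendsto_const_div_atTop_nhds_zero_nat 1)
    rw [mul_zero] at h
    refine h.congr' ?_
    filter_upwards [eventually_gt_atTop 0] with n hn
    have hn' : (n : ℝ) ≠ 0 := by positivity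
    have := (hpos n).ne'
    field_simp
  refine tendsto_div_of_linear_recursion (x := fun n => (degreeCount t (m + 1) n : ℝ))
    (b := fun n => (m + a) * (1 / ((a + 1) * n + a)))
    (r := fun n => δ (m + 1) * (1 - (m + a) * (1 / ((a + 1) * n + a)))
      + (m + a - 1) * ((n : ℝ) / ((a + 1) * n + a) * (degreeCount t m n / n)
        + 1 / ((a + 1) * n + a) * δ m)) (ξ := ξ)
    (by positivity) (fun n => by have := hpos n; positivity) ?_ ?_ hξ ?_
  · have h := hratio.const_mul (m + a)
    rw [mul_one_div] at h
    refine h.congr fun n => ?_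
    ring
  · have h := (((hinv.const_mul (m + a)).const_sub 1).const_mul (δ (m + 1))).add
      (((hratio.mul hq).add (hinv.mul_const (δ m))).const_mul (m + a - 1))
    convert h using 2
    simp only [hδ, Nat.add_eq_right]
    ring
  · intro n hn
    have hn' : (n : ℝ) ≠ 0 := by positivity
    have := (hpos n).ne'
    rw [hrec n hn, midCount_eq ht, midCount_eq ht]
    change (degreeCount t (m + 1) n + δ (m + 1)) + ((m + a - 1) * (degreeCount t m n + δ m)
      - (m + a) * (degreeCount t (m + 1) n + δ (m + 1))) / ((a + 1) * n + a) + ξ n = _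
    field_simp
    ring

theorem limitProportion_one {a : ℝ} (ha : 0 < a) :
    limitProportion a 1 = 1 / (1 + a / (a + 1)) := by
  have h : 2 * a + 1 ≠ 0 := by positivity
  have h' : a + 1 + a ≠ 0 := by positivity
  simp only [limitProportion, Nat.sub_self, ascPochhammer_zero, Polynomial.eval_one,
    ascPochhammer_one, Polynomial.eval_X]
  field_simp
  ring

theorem limitProportion_succ {a : ℝ} (ha : 0 < a) (m : ℕ) :
    limitProportion a (m + 2)
      = (m + a) / (a + 1) * limitProportion a (m + 1) / (1 + (m + 1 + a) / (a + 1)) := by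
  have h : (ascPochhammer ℝ (m + 1)).eval (2 * a + 1) ≠ 0 :=
    (ascPochhammer_pos (m + 1) (2 * a + 1) (by positivity)).ne'
  have h1 : 2 * a + 1 + ((m + 1 : ℕ) : ℝ) ≠ 0 := by positivity
  have h2 : a + 1 + (m + 1 + a) ≠ 0 := by positivity
  rw [limitProportion, limitProportion, show m + 2 - 1 = m + 1 from rfl, Nat.add_sub_cancel,
    ascPochhammer_succ_eval (n := m + 1), ascPochhammer_succ_eval (n := m)]
  push_cast at h1 ⊢
  field_simp
  ring

end BuckleyOsthus

theorem proposition1 {Ω : Type*} [MeasurableSpace Ω] (μ : Measure Ω) [IsProbabilityMeasure μ]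
    (a₀ : ℝ) (ha₀ : 0 < a₀) (V : ℕ → Ω → ℕ) (hV : BuckleyOsthus.IsProcess μ a₀ V)
    (k : ℕ) (hk : 1 ≤ k) :
    ∀ᵐ ω ∂μ, Tendsto
      (fun n : ℕ => (BuckleyOsthus.degreeCount (fun j => V j ω) k n : ℝ) / (n : ℝ))
      atTop (𝓝 (BuckleyOsthus.limitProportion a₀ k)) := by
  filter_upwards [hV.ae_le, ae_all_iff.2 hV.ae_exists_recursion] with ω ht hrec
  induction k, hk using Nat.le_induction with
  | base =>
    obtain ⟨ξ, hξ, h⟩ := hrec 0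
    have hzero : Tendsto (fun n : ℕ =>
        (BuckleyOsthus.degreeCount (fun j => V j ω) 0 n : ℝ) / (n : ℝ)) atTop (𝓝 0) := by
      simp [BuckleyOsthus.degreeCount_zero]
    have hlim := BuckleyOsthus.tendsto_degreeCount_succ ht ha₀ hξ h hzero
    rw [BuckleyOsthus.limitProportion_one ha₀]
    simpa using hlim
  | succ k hk ih =>
    obtain ⟨m, rfl⟩ := Nat.exists_eq_add_of_le' hk
    obtain ⟨ξ, hξ, h⟩ := hrec (m + 1)
    have hlim := BuckleyOsthus.tendsto_degreeCount_succ ht ha₀ hξ h ih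
    rw [BuckleyOsthus.limitProportion_succ ha₀]
    convert hlim using 2
    push_cast
    ring
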